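/- All graphs are finite and simple. For a real square matrix $M=[a_{ij}]_{m\times m}$ let $\mathrm{per}(M)=\sum_{\sigma}\prod_{i=1}^m a_{i\sigma(i)}$, the sum over all permutations $\sigma$ of $\{1,\dots,m\}$. The permanent index $\mathrm{pind}(M)$ of a real matrix $M$ is the least integer $k\ge 0$ for which there is a square matrix $M'$ with $\mathrm{per}(M')\neq 0$, each column of which is a column of $M$, and in which each (indexed) column of $M$ is used at most $k$ times ($\mathrm{pind}(M)=\infty$ if no such $k$ exists). For a graph $G$ with an orientation of its edges, let $B_G$ be the matrix with rows and columns indexed by $E(G)$ such that, for an edge $e$ oriented from $u$ to $v$, $B_G[e,y]=1$ if $y\ne e$ is incident to $v$, $B_G[e,y]=-1$ if $y\neq e$ is incident to $u$, and $B_G[e,y]=0$ otherwise. The graph $G$ is $(k,k')$-choosable if, for every assignment $L$ of a set of $k$ real numbers to each vertex and a set of $k'$ real numbers to each edge, there is $f:V(G)\cup E(G)\to\mathbb{R}$ with $f(z)\in L(z)$ for all $z$ and $$f(u)+\sum_{e\ni u}f(e)\neq f(v)+\sum_{e\ni v}f(e)$$ for all adjacent $u,v$. A bicyclic graph is a connected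 graph with $n$ vertices and $m=n+1$ edges (such a graph contains two or three cycles). **Theorem.** For every bicyclic graph $B$ and every orientation of its edges, $\mathrm{pind}(B_B)\le 2$. Hence every connected graph with $m=n+1$ is $(1,3)$-choosable. -/

import Mathlib

/-- The property defining the permanent index: there is a square matrix `A'` with nonzero
permanent, each of whose columns is a column of `A` (column `i` of `A'` is column `f i` of `A`),
such that each column of `A` is used at most `k` times. -/
def Matrix.HasNonzeroPermSelection {m n : Type*} [Fintype m] [DecidableEq m] [DecidableEq n]
    (A : Matrix m n ℝ) (k : ℕ) : Prop :=
  ∃ f : m → n, (∀ j : n, (Finset.univ.filter fun i : m => f i = j).card ≤ k) ∧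
    (A.submatrix id f).permanent ≠ 0

/-- The permanent index of `A`: the least `k` such that some square matrix formed from columns of
`A`, each used at most `k` times, has nonzero permanent; it is `⊤` if there is no such `k`. -/
noncomputable def Matrix.pind {m n : Type*} [Fintype m] [DecidableEq m] [DecidableEq n]
    (A : Matrix m n ℝ) : ℕ∞ :=
  ⨅ (k : ℕ) (_ : A.HasNonzeroPermSelection k), (k : ℕ∞)

namespace SimpleGraph

variable {V : Type*}

/-- An orientation of `G`: every edge gets a tail and a head, which are its two endpoints. -/
structure EdgeOrientation (G : SimpleGraph V) where
  tail : G.edgeSet → V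
  head : G.edgeSet → V
  mk_tail_head : ∀ e : G.edgeSet, s(tail e, head e) = (e : Sym2 V)

/-- The condition on a column `y` (a vertex or an edge) in row `e`: either `y` is the vertex
`v`, or `y ≠ e` is an edge incident to `v`. -/
def Touches {G : SimpleGraph V} (e : G.edgeSet) (v : V) : V ⊕ G.edgeSet → Prop
  | Sum.inl w => w = v
  | Sum.inr y => y ≠ e ∧ v ∈ (y : Sym2 V)

open Classical in
/-- The matrix `A_G`, rows indexed by edges, columns indexed by vertices and edges. -/
noncomputable def totalMatrix {G : SimpleGraph V} (D : G.EdgeOrientation) :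
    Matrix G.edgeSet (V ⊕ G.edgeSet) ℝ :=
  Matrix.of fun e y =>
    if Touches e (D.head e) y then 1 else if Touches e (D.tail e) y then -1 else 0

/-- The matrix `B_G`: the submatrix of `A_G` on the columns indexed by edges. -/
noncomputable def edgeMatrix {G : SimpleGraph V} (D : G.EdgeOrientation) :
    Matrix G.edgeSet G.edgeSet ℝ :=
  (totalMatrix D).submatrix id Sum.inr

section Weighting

variable [Fintype V] [DecidableEq V] (G : SimpleGraph V) [DecidableRel G.Adj]

/-- The weight of `v` under the total weighting `f`: its own weight plus the weights of all edges
incident to it. -/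
noncomputable def vertexWeight (f : V ⊕ G.edgeSet → ℝ) (v : V) : ℝ :=
  f (Sum.inl v) +
    ∑ e ∈ Finset.univ.filter (fun e : G.edgeSet => v ∈ (e : Sym2 V)), f (Sum.inr e)

/-- A total weighting is proper if adjacent vertices have distinct weights. -/
def IsProperTotalWeighting (f : V ⊕ G.edgeSet → ℝ) : Prop :=
  ∀ u v : V, G.Adj u v → G.vertexWeight f u ≠ G.vertexWeight f v

/-- `G` is total weight `ψ`-choosable: for any assignment of lists of `ψ z` real numbers to
vertices and edges `z`, there is a proper total weighting with weights from the lists. -/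
def IsTotalWeightChoosable (ψ : V ⊕ G.edgeSet → ℕ) : Prop :=
  ∀ L : V ⊕ G.edgeSet → Finset ℝ, (∀ z, (L z).card = ψ z) →
    ∃ f : V ⊕ G.edgeSet → ℝ, (∀ z, f z ∈ L z) ∧ G.IsProperTotalWeighting f

/-- Total weight `(k, k')`-choosability: lists of size `k` on vertices and `k'` on edges. -/
def IsChoosable (k k' : ℕ) : Prop :=
  G.IsTotalWeightChoosable (Sum.elim (fun _ => k) (fun _ => k'))

/-- A bicyclic graph: connected with exactly one more edge than vertices. (Such a graph
automatically contains two or three cycles.) -/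
def IsBicyclic : Prop :=
  G.Connected ∧ G.edgeFinset.card = Fintype.card V + 1

end Weighting

end SimpleGraph

/-! Let `P` be the product over the rows of the edge matrix of their linear forms in edge variables.
Up to positive factors its coefficients are sums of permanents of matrices built from columns, so a
monomial of `P` with all exponents at most 2 and nonzero coefficient gives the permanent index
bound; the combinatorial Nullstellensatz turns the same monomial into choosability. The coefficients
are integers, so it suffices that `P` mod 3 lies outside the ideal generated by the cubes of the
variables (`rowProd_notMem`).

Characteristic 3 helps twice. Cubes of linear forms lie in the cube ideal, so edge variables may be
replaced by linear forms in vertex variables; `P` then becomes the product of `Y u - Y v` over the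
edges, where `Y` is the vector of vertex sums. Moreover the cube ideal is stable under partial
derivatives, so a variable of degree 2 can be eliminated by differentiating twice.

If the incidence map is onto mod 3, `Y` can be the vector of independent variables. Every induced
subgraph has at most one more edge than vertices, hence a vertex of degree at most 2, and vertices
are eliminated one by one. Otherwise there are alternating signs `s`, and `Y` is free up to the
relation `∑ s v * Y v = 0`. Eliminating a root `r` leaves the graph polynomial of the rest times one
factor per neighbour of `r`. A leaf, or one of two adjacent vertices of degree 2, serves as root and
reduces the problem to a graph polynomial times one linear form (`LinGood`); the only remaining
graph is the complete bipartite graph with parts 2 and 3, computed by hand. -/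

open MvPolynomial

/-! ### The cube ideal in characteristic 3 -/

/-- The ideal generated by the cubes of the variables, over the field with three elements. -/
noncomputable def cubeIdeal (σ : Type*) : Ideal (MvPolynomial σ (ZMod 3)) :=
  Ideal.span (Set.range fun i => X i ^ 3)

namespace cubeIdeal

variable {σ τ : Type*}

lemma three_eq_zero : (3 : MvPolynomial σ (ZMod 3)) = 0 := by
  rw [← map_ofNat (C : ZMod 3 →+* MvPolynomial σ (ZMod 3)) 3, show (3 : ZMod 3) = 0 from rfl, C_0]

lemma one_notMem : (1 : MvPolynomial σ (ZMod 3)) ∉ cubeIdeal σ := by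
  have h : cubeIdeal σ ≤ RingHom.ker (constantCoeff : MvPolynomial σ (ZMod 3) →+* ZMod 3) := by
    rw [cubeIdeal, Ideal.span_le]
    rintro _ ⟨i, rfl⟩
    simp [RingHom.mem_ker]
  intro h1
  simpa [RingHom.mem_ker] using h h1

lemma C_mul_mem_iff {c : ZMod 3} (hc : c ≠ 0) {p : MvPolynomial σ (ZMod 3)} :
    C c * p ∈ cubeIdeal σ ↔ p ∈ cubeIdeal σ := by
  refine ⟨fun h => ?_, fun h => Ideal.mul_mem_left _ _ h⟩
  have := Ideal.mul_mem_left _ (C c⁻¹) h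
  rwa [← mul_assoc, ← C_mul, inv_mul_cancel₀ hc, C_1, one_mul] at this

/-- The derivative of a cube carries a factor 3, so the Leibniz rule keeps the ideal stable. -/
lemma pderiv_mem (v : σ) {p : MvPolynomial σ (ZMod 3)} (hp : p ∈ cubeIdeal σ) :
    pderiv v p ∈ cubeIdeal σ := by
  induction hp using Submodule.span_induction with
  | mem x hx =>
    obtain ⟨i, rfl⟩ := hx
    have : pderiv v (X i ^ 3 : MvPolynomial σ (ZMod 3)) = 0 := by
      rw [Derivation.leibniz_pow]
      linear_combination (exp := 1) (X i ^ 2 * pderiv v (X i : MvPolynomial σ (ZMod 3))) *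
        three_eq_zero (σ := σ)
    rw [this]
    exact Ideal.zero_mem _
  | zero => simp
  | add x y _ _ hx hy => simpa using Ideal.add_mem _ hx hy
  | smul a x hx hx' =>
    rw [smul_eq_mul, Derivation.leibniz]
    exact Ideal.add_mem _ (Ideal.mul_mem_left _ _ hx') (Ideal.mul_mem_right _ _ hx)

/-- Cubing is additive in characteristic 3. -/
lemma linear_pow_three_mem [Fintype σ] (a : σ → ZMod 3) :
    (∑ i, C (a i) * X i) ^ 3 ∈ cubeIdeal σ := by
  rw [sum_pow_char 3]
  refine Ideal.sum_mem _ fun i _ => ?_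
  rw [mul_pow]
  exact Ideal.mul_mem_left _ _ (Ideal.subset_span ⟨i, rfl⟩)

lemma aeval_mem {t : σ → MvPolynomial τ (ZMod 3)} (ht : ∀ i, t i ^ 3 ∈ cubeIdeal τ)
    {p : MvPolynomial σ (ZMod 3)} (hp : p ∈ cubeIdeal σ) : aeval t p ∈ cubeIdeal τ := by
  have h : cubeIdeal σ ≤ (cubeIdeal τ).comap (aeval t) := by
    rw [cubeIdeal, Ideal.span_le]
    rintro _ ⟨i, rfl⟩
    simpa using ht i
  exact h hp

/-- The ideal is monomial: a polynomial all of whose monomials have an exponent at least 3 belongs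
to it. -/
lemma exists_coeff_ne_zero {p : MvPolynomial σ (ZMod 3)} (hp : p ∉ cubeIdeal σ) :
    ∃ k : σ →₀ ℕ, coeff k p ≠ 0 ∧ ∀ i, k i ≤ 2 := by
  contrapose! hp
  rw [p.as_sum]
  refine Ideal.sum_mem _ fun k hk => ?_
  obtain ⟨i, hi⟩ := hp k (mem_support_iff.1 hk)
  have hle : Finsupp.single i 3 ≤ k := by
    rw [Finsupp.single_le_iff]
    exact hi
  have : monomial k (coeff k p) = monomial (k - Finsupp.single i 3) (coeff k p) * X i ^ 3 := by
    rw [X_pow_eq_monomial, monomial_mul, mul_one, tsub_add_cancel_of_le hle]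
  rw [this]
  exact Ideal.mul_mem_left _ _ (Ideal.subset_span ⟨i, rfl⟩)

variable {v : σ} {q α β m : MvPolynomial σ (ZMod 3)}

/-- Two derivatives stay in the ideal, and 2 is its own inverse mod 3. This extracts the coefficient
of the square of `X v`. -/
lemma notMem_of_two_mul {p : MvPolynomial σ (ZMod 3)} (hp : p ∉ cubeIdeal σ)
    {r : MvPolynomial σ (ZMod 3)} (hr : pderiv v (pderiv v r) = 2 * p) : r ∉ cubeIdeal σ := by
  intro h
  have h2 := pderiv_mem v (pderiv_mem v h)
  rw [hr] at h2
  apply hp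
  have : p = 2 * (2 * p) := by linear_combination (-p) * three_eq_zero (σ := σ)
  rw [this]
  exact Ideal.mul_mem_left _ _ h2

lemma mul_linear_notMem (hq : pderiv v q = 0) (hm : pderiv v m = 0) {c : ZMod 3} (hc : c ≠ 0)
    (h : q ∉ cubeIdeal σ) : q * (C c * X v + m) ∉ cubeIdeal σ := by
  intro h1
  have h2 := pderiv_mem v h1
  have h3 : pderiv v (q * (C c * X v + m)) = C c * q := by
    simp [Derivation.leibniz, hq, hm]; ring
  rw [h3, C_mul_mem_iff hc] at h2
  exact h h2

lemma mul_sub_notMem (hq : pderiv v q = 0) (hα : pderiv v α = 0)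
    (h : q ∉ cubeIdeal σ) : q * (X v - α) ∉ cubeIdeal σ := by
  have := mul_linear_notMem (v := v) (m := -α) hq (by simp [hα]) one_ne_zero h
  simpa [sub_eq_add_neg] using this

lemma mul_sub_mul_sub_notMem (hq : pderiv v q = 0) (hα : pderiv v α = 0) (hβ : pderiv v β = 0)
    (h : q ∉ cubeIdeal σ) : q * ((X v - α) * (X v - β)) ∉ cubeIdeal σ := by
  refine notMem_of_two_mul (v := v) h ?_
  simp [Derivation.leibniz, hq, hα, hβ]; ring

lemma mul_sub_mul_linear_notMem (hq : pderiv v q = 0) (hα : pderiv v α = 0)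
    (hm : pderiv v m = 0) {c : ZMod 3} (hc : c ≠ 0) (h : q ∉ cubeIdeal σ) :
    q * ((X v - α) * (C c * X v + m)) ∉ cubeIdeal σ := by
  refine notMem_of_two_mul (v := v) (p := C c * q) (by rwa [C_mul_mem_iff hc]) ?_
  simp [Derivation.leibniz, hq, hα, hm]; ring

/-- The product is cubic in `X v`, but the second derivative of the cubic term is divisible by 6.
What survives is twice the coefficient of the square, `m - C c * (α + β)`. -/
lemma mul_sub_mul_sub_mul_linear_notMem (hq : pderiv v q = 0) (hα : pderiv v α = 0)
    (hβ : pderiv v β = 0) (hm : pderiv v m = 0) {c : ZMod 3}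
    (h : q * (m - C c * (α + β)) ∉ cubeIdeal σ) :
    q * ((X v - α) * (X v - β) * (C c * X v + m)) ∉ cubeIdeal σ := by
  refine notMem_of_two_mul (v := v) h ?_
  simp [Derivation.leibniz, hq, hα, hβ, hm]
  linear_combination (2 * C c * X v * q) * three_eq_zero (σ := σ)

end cubeIdeal

/-! ### Degree sums of induced subgraphs -/

namespace SimpleGraph

section NeighborsIn

variable {V : Type*} (G : SimpleGraph V) [DecidableRel G.Adj]

/-- The neighbours of `v` that lie in `K`. -/
def neighborsIn (K : Finset V) (v : V) : Finset V := K.filter (G.Adj v)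

/-- The sum of the degrees of the subgraph induced on `K`. -/
def degSum (K : Finset V) : ℕ := ∑ v ∈ K, (G.neighborsIn K v).card

variable {G}

lemma mem_neighborsIn {K : Finset V} {u v : V} :
    u ∈ G.neighborsIn K v ↔ u ∈ K ∧ G.Adj v u := Finset.mem_filter

lemma degSum_univ [Fintype V] : G.degSum Finset.univ = 2 * G.edgeFinset.card := by
  rw [← sum_degrees_eq_twice_card_edges, degSum]
  refine Finset.sum_congr rfl fun v _ => ?_
  rw [← card_neighborFinset_eq_degree]
  congr 1
  ext u
  simp [mem_neighborsIn]

variable [DecidableEq V]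

lemma neighborsIn_erase (K : Finset V) (u v : V) :
    G.neighborsIn (K.erase v) u = (G.neighborsIn K u).erase v :=
  Finset.filter_erase ..

lemma card_neighborsIn_erase {K : Finset V} {u v : V} (hv : v ∈ K) (h : G.Adj u v) :
    (G.neighborsIn (K.erase v) u).card + 1 = (G.neighborsIn K u).card := by
  rw [neighborsIn_erase, Finset.card_erase_add_one (mem_neighborsIn.2 ⟨hv, h⟩)]

lemma neighborsIn_erase_of_not_adj (K : Finset V) {u v : V} (h : ¬ G.Adj u v) :
    G.neighborsIn (K.erase v) u = G.neighborsIn K u := by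
  rw [neighborsIn_erase, Finset.erase_eq_of_notMem fun hm => h (mem_neighborsIn.1 hm).2]

lemma degSum_erase {K : Finset V} {v : V} (hv : v ∈ K) :
    G.degSum K = G.degSum (K.erase v) + 2 * (G.neighborsIn K v).card := by
  have h1 : ∀ u ∈ K.erase v, (G.neighborsIn K u).card =
      (G.neighborsIn (K.erase v) u).card + if G.Adj v u then 1 else 0 := by
    intro u _
    split_ifs with h
    · rw [card_neighborsIn_erase hv h.symm]
    · rw [neighborsIn_erase_of_not_adj K fun h' => h h'.symm, add_zero]
  have h2 : ∑ u ∈ K.erase v, (if G.Adj v u then 1 else 0) = (G.neighborsIn K v).card := by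
    rw [← Finset.card_filter]
    congr 1
    ext u
    simp only [Finset.mem_filter, Finset.mem_erase, mem_neighborsIn]
    exact ⟨fun h => ⟨h.1.2, h.2⟩, fun h => ⟨⟨h.2.ne', h.1⟩, h.2⟩⟩
  rw [degSum, ← Finset.add_sum_erase K _ hv, Finset.sum_congr rfl h1, Finset.sum_add_distrib, h2,
    degSum]
  ring

/-- In a connected graph, a nonempty set of vertices misses at least as many edges as vertices. -/
lemma Connected.degSum_add_le [Fintype V] (hG : G.Connected) (K : Finset V) (hK : K.Nonempty) :
    G.degSum K + 2 * Fintype.card V ≤ G.degSum Finset.univ + 2 * K.card := by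
  by_cases h : K = Finset.univ
  · rw [h, Finset.card_univ]
  · obtain ⟨x, hx⟩ := hK
    obtain ⟨y, hy⟩ : ∃ y, y ∉ K := by
      by_contra! h'
      exact h (Finset.eq_univ_iff_forall.2 h')
    obtain ⟨p⟩ := hG.preconnected x y
    -- Adding the outer end of an edge that leaves `K` adds one vertex and at least one edge, so the
    -- bound for the larger set implies the one for `K`.
    obtain ⟨d, -, hd1, hd2⟩ := p.exists_boundary_dart (K : Set V) hx hy
    have hd2' : d.snd ∉ K := hd2
    have ih := hG.degSum_add_le (insert d.snd K) (Finset.insert_nonempty _ _)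
    have h1 := degSum_erase (G := G) (Finset.mem_insert_self d.snd K)
    rw [Finset.erase_insert hd2'] at h1
    rw [Finset.card_insert_of_notMem hd2'] at ih
    have h2 : 0 < (G.neighborsIn (insert d.snd K) d.snd).card :=
      Finset.card_pos.2 ⟨d.fst, mem_neighborsIn.2 ⟨Finset.mem_insert_of_mem hd1, d.adj.symm⟩⟩
    lia
termination_by Fintype.card V - K.card
decreasing_by
  rw [Finset.card_insert_of_notMem hd2']
  have := Finset.card_lt_univ_of_notMem hd2'
  lia

lemma degSum_le_sq (K : Finset V) : G.degSum K ≤ K.card * (K.card - 1) := by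
  rw [degSum, ← smul_eq_mul]
  refine Finset.sum_le_card_nsmul _ _ _ fun v hv => ?_
  rw [← Finset.card_erase_of_mem hv]
  refine Finset.card_le_card fun u hu => ?_
  rw [mem_neighborsIn] at hu
  exact Finset.mem_erase.2 ⟨hu.2.ne', hu.1⟩

end NeighborsIn

/-! ### The graph polynomial and removal of vertices -/

namespace EdgeOrientation

variable {V : Type*} {G : SimpleGraph V} (D : G.EdgeOrientation)

/-- The endpoint of `e` other than `v`. -/
noncomputable def other [DecidableEq V] (v : V) (e : G.edgeSet) : V :=
  if D.tail e = v then D.head e else D.tail e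

lemma adj (e : G.edgeSet) : G.Adj (D.tail e) (D.head e) := by
  rw [← mem_edgeSet, D.mk_tail_head]
  exact e.2

variable [Fintype V] [DecidableEq V] [DecidableRel G.Adj]

/-- The product of the differences of `Y` along the edges inside `K`. -/
noncomputable def edgeProd {R : Type*} [CommRing R] (Y : V → R) (K : Finset V) : R :=
  ∏ e : G.edgeSet with D.tail e ∈ K ∧ D.head e ∈ K, (Y (D.head e) - Y (D.tail e))

lemma edgeProd_congr {R : Type*} [CommRing R] {Y Z : V → R} {K : Finset V}
    (h : ∀ v ∈ K, Y v = Z v) : D.edgeProd Y K = D.edgeProd Z K := by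
  refine Finset.prod_congr rfl fun e he => ?_
  rw [Finset.mem_filter] at he
  rw [h _ he.2.1, h _ he.2.2]

/-- The edges at `v` are split off; reversing those with tail `v` costs only a sign. -/
lemma edgeProd_erase {σ : Type*} (Y : V → MvPolynomial σ (ZMod 3)) {K : Finset V} {v : V}
    (hv : v ∈ K) : ∃ c : ZMod 3, c ≠ 0 ∧ D.edgeProd Y K =
      C c * (D.edgeProd Y (K.erase v) * ∏ a ∈ G.neighborsIn K v, (Y v - Y a)) := by
  classical
  set S : Finset G.edgeSet := Finset.univ.filter fun e => D.tail e ∈ K ∧ D.head e ∈ K with hS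
  let T := S.filter fun e => D.tail e = v ∨ D.head e = v
  let sgn : G.edgeSet → ZMod 3 := fun e => if D.tail e = v then -1 else 1
  refine ⟨∏ e ∈ T, sgn e, ?_, ?_⟩
  · rw [Finset.prod_ne_zero_iff]
    intro e _
    simp only [sgn]
    split_ifs <;> decide
  have h1 : D.edgeProd Y (K.erase v) =
      ∏ e ∈ S.filter fun e => ¬ (D.tail e = v ∨ D.head e = v),
        (Y (D.head e) - Y (D.tail e)) := by
    rw [edgeProd]
    congr 1
    ext e
    simp only [hS, Finset.mem_filter, Finset.mem_univ, true_and, Finset.mem_erase]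
    tauto
  have h2 : ∏ e ∈ T, (Y (D.head e) - Y (D.tail e)) =
      C (∏ e ∈ T, sgn e) * ∏ e ∈ T, (Y v - Y (D.other v e)) := by
    rw [map_prod, ← Finset.prod_mul_distrib]
    refine Finset.prod_congr rfl fun e he => ?_
    have := (Finset.mem_filter.1 he).2
    simp only [sgn, other]
    split_ifs with h
    · simp [h]
    · rw [this.resolve_left h]; simp
  have h3 : ∏ e ∈ T, (Y v - Y (D.other v e)) = ∏ a ∈ G.neighborsIn K v, (Y v - Y a) := by
    have key : ∀ e ∈ T, s(v, D.other v e) = (e : Sym2 V) := by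
      intro e he
      have := (Finset.mem_filter.1 he).2
      rw [← D.mk_tail_head, other]
      split_ifs with h
      · rw [h]
      · rw [this.resolve_left h, Sym2.eq_swap]
    refine Finset.prod_bij (fun e _ => D.other v e) ?_ ?_ ?_ fun _ _ => rfl
    · intro e he
      have h4 := key e he
      have h5 := (Finset.mem_filter.1 (Finset.mem_filter.1 he).1).2
      rw [mem_neighborsIn]
      refine ⟨?_, ?_⟩
      · rw [other]; split_ifs
        exacts [h5.2, h5.1]
      · rw [← mem_edgeSet, h4]; exact e.2
    · intro e he e' he' h
      apply Subtype.ext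
      rw [← key e he, ← key e' he', h]
    · intro a ha
      rw [mem_neighborsIn] at ha
      let e : G.edgeSet := ⟨s(v, a), ha.2⟩
      have h4 : s(D.tail e, D.head e) = s(v, a) := D.mk_tail_head e
      refine ⟨e, ?_, ?_⟩
      · simp only [T, hS, Finset.mem_filter, Finset.mem_univ, true_and]
        rcases Sym2.eq_iff.1 h4 with ⟨h, h'⟩ | ⟨h, h'⟩ <;> simp [h, h', hv, ha.1]
      · rcases Sym2.eq_iff.1 h4 with ⟨h, h'⟩ | ⟨h, h'⟩ <;> simp [other, h, h', ha.2.ne']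
  rw [h1, ← h3, mul_comm (∏ e ∈ S.filter _, _), ← mul_assoc, ← h2,
    Finset.prod_filter_mul_prod_filter_not]
  rfl

/-- The product of the differences of the variables along the edges inside `K`. -/
noncomputable abbrev graphPoly (K : Finset V) : MvPolynomial V (ZMod 3) :=
  D.edgeProd X K

lemma pderiv_graphPoly {K : Finset V} {v : V} (hv : v ∉ K) : pderiv v (D.graphPoly K) = 0 := by
  refine Finset.prod_induction _ (fun p => pderiv v p = 0) ?_ (pderiv_one) ?_
  · intro a b ha hb
    simp [Derivation.leibniz, ha, hb]
  · intro e he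
    have := (Finset.mem_filter.1 he).2
    rw [map_sub, pderiv_X_of_ne (ne_of_mem_of_not_mem this.2 hv),
      pderiv_X_of_ne (ne_of_mem_of_not_mem this.1 hv), sub_zero]

lemma mul_graphPoly_mem_iff {K : Finset V} {v : V} (hv : v ∈ K) (q : MvPolynomial V (ZMod 3)) :
    D.graphPoly K * q ∈ cubeIdeal V ↔
      D.graphPoly (K.erase v) * (∏ a ∈ G.neighborsIn K v, (X v - X a)) * q ∈ cubeIdeal V := by
  obtain ⟨c, hc, h⟩ := D.edgeProd_erase X hv
  rw [graphPoly, h, mul_assoc, cubeIdeal.C_mul_mem_iff hc]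

/-- Removing a vertex with at most two neighbours. -/
lemma graphPoly_mul_notMem {K : Finset V} {v : V} (hv : v ∈ K)
    (hd : (G.neighborsIn K v).card ≤ 2) {q : MvPolynomial V (ZMod 3)} (hq : pderiv v q = 0)
    (h : D.graphPoly (K.erase v) * q ∉ cubeIdeal V) : D.graphPoly K * q ∉ cubeIdeal V := by
  rw [D.mul_graphPoly_mem_iff hv, mul_right_comm]
  have hq' : pderiv v (D.graphPoly (K.erase v) * q) = 0 := by
    simp [Derivation.leibniz, hq, D.pderiv_graphPoly (Finset.notMem_erase v K)]
  have hX : ∀ a ∈ G.neighborsIn K v, pderiv v (X a : MvPolynomial V (ZMod 3)) = 0 := fun a ha =>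
    pderiv_X_of_ne (mem_neighborsIn.1 ha).2.ne'
  interval_cases hc : (G.neighborsIn K v).card
  · rw [Finset.card_eq_zero.1 hc]
    simpa using h
  · obtain ⟨a, ha⟩ := Finset.card_eq_one.1 hc
    rw [ha] at hX ⊢
    rw [Finset.prod_singleton]
    exact cubeIdeal.mul_sub_notMem hq' (hX a (by simp)) h
  · obtain ⟨a, b, hab, ha⟩ := Finset.card_eq_two.1 hc
    rw [ha] at hX ⊢
    rw [Finset.prod_pair hab]
    exact cubeIdeal.mul_sub_mul_sub_notMem hq' (hX a (by simp)) (hX b (by simp)) h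

lemma graphPoly_notMem (hdeg : ∀ K : Finset V, K.Nonempty → ∃ v ∈ K, (G.neighborsIn K v).card ≤ 2)
    (K : Finset V) : D.graphPoly K ∉ cubeIdeal V := by
  induction K using Finset.strongInduction with
  | H K ih =>
    rcases K.eq_empty_or_nonempty with rfl | hK
    · simpa [graphPoly, edgeProd] using cubeIdeal.one_notMem (σ := V)
    · obtain ⟨v, hv, hd⟩ := hdeg K hK
      simpa using D.graphPoly_mul_notMem (q := 1) hv hd pderiv_one
        (by simpa using ih _ (Finset.erase_ssubset hv))

end EdgeOrientation

end SimpleGraph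

/-! ### The graph polynomial times a linear form -/

namespace SimpleGraph

variable {V : Type*} {G : SimpleGraph V} [DecidableRel G.Adj]

/-- If the average degree on `K` is at most two and all degrees are at least two, then all degrees
are two. -/
lemma card_neighborsIn_eq_two {K : Finset V} (hs : G.degSum K ≤ 2 * K.card)
    (h : ∀ v ∈ K, 2 ≤ (G.neighborsIn K v).card) : ∀ v ∈ K, (G.neighborsIn K v).card = 2 := by
  have h1 : ∑ v ∈ K, 2 = ∑ v ∈ K, (G.neighborsIn K v).card := by
    refine le_antisymm (Finset.sum_le_sum h) ?_
    rw [Finset.sum_const, smul_eq_mul, mul_comm]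
    exact hs
  exact fun v hv => ((Finset.sum_eq_sum_iff_of_le h).1 h1 v hv).symm

/-- Minimum degree 3 would force `3 * K.card ≤ 2 * K.card + 2`, so at most two vertices, which is
too few for degree 3. -/
lemma exists_card_neighborsIn_le_two [DecidableEq V]
    (hsum : ∀ K : Finset V, K.Nonempty → G.degSum K ≤ 2 * K.card + 2)
    (K : Finset V) (hK : K.Nonempty) : ∃ v ∈ K, (G.neighborsIn K v).card ≤ 2 := by
  by_contra! h
  have h1 : K.card * 3 ≤ G.degSum K := by
    rw [degSum, ← smul_eq_mul]
    exact Finset.card_nsmul_le_sum _ _ _ h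
  have h2 := hsum K hK
  have h3 := degSum_le_sq (G := G) K
  have h4 := hK.card_pos
  have h5 : K.card ≤ 2 := by lia
  interval_cases hc : K.card <;> lia

namespace EdgeOrientation

/-- The linear form with coefficients `c` on `K`. -/
noncomputable def linForm (K : Finset V) (c : V → ZMod 3) : MvPolynomial V (ZMod 3) :=
  ∑ u ∈ K, C (c u) * X u

lemma linForm_congr {K : Finset V} {c c' : V → ZMod 3} (h : ∀ v ∈ K, c v = c' v) :
    linForm K c = linForm K c' :=
  Finset.sum_congr rfl fun v hv => by rw [h v hv]

lemma pderiv_linForm {K : Finset V} {v : V} (hv : v ∉ K) (c : V → ZMod 3) :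
    pderiv v (linForm K c) = 0 := by
  rw [linForm, map_sum]
  refine Finset.sum_eq_zero fun u hu => ?_
  rw [pderiv_C_mul, pderiv_X_of_ne (ne_of_mem_of_not_mem hu hv), mul_zero]

variable [DecidableEq V]

lemma linForm_eq {K : Finset V} {v : V} (hv : v ∈ K) (c : V → ZMod 3) :
    linForm K c = C (c v) * X v + linForm (K.erase v) c :=
  (Finset.add_sum_erase K _ hv).symm

variable [Fintype V] (D : G.EdgeOrientation) {K : Finset V} {c : V → ZMod 3} {v : V}

/-- The graph polynomial of `K` times a linear form is not in the ideal of cubes. -/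
def LinGood (K : Finset V) (c : V → ZMod 3) : Prop :=
  D.graphPoly K * linForm K c ∉ cubeIdeal V

/-- Here the product has degree at most 2 in `X v`, with leading coefficient `c v` times the graph
polynomial of the rest; the linear form disappears altogether. -/
lemma linGood_of_card_le_one
    (hsum : ∀ K : Finset V, K.Nonempty → G.degSum K ≤ 2 * K.card + 2) (hv : v ∈ K)
    (hd : (G.neighborsIn K v).card ≤ 1) (hc : c v ≠ 0) : D.LinGood K c := by
  rw [LinGood, D.mul_graphPoly_mem_iff hv, linForm_eq hv, mul_assoc]
  have h := D.graphPoly_notMem (exists_card_neighborsIn_le_two hsum) (K.erase v)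
  have hq := D.pderiv_graphPoly (Finset.notMem_erase v K)
  have hm := pderiv_linForm (Finset.notMem_erase v K) c
  interval_cases hc' : (G.neighborsIn K v).card
  · rw [Finset.card_eq_zero.1 hc', Finset.prod_empty, one_mul]
    exact cubeIdeal.mul_linear_notMem hq hm hc h
  · obtain ⟨a, ha⟩ := Finset.card_eq_one.1 hc'
    have ha' : a ∈ G.neighborsIn K v := by simp [ha]
    rw [ha, Finset.prod_singleton]
    exact cubeIdeal.mul_sub_mul_linear_notMem hq
      (pderiv_X_of_ne (mem_neighborsIn.1 ha').2.ne') hm hc h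

lemma linGood_of_erase_zero (hv : v ∈ K) (hd : (G.neighborsIn K v).card ≤ 2) (hc : c v = 0)
    (h : D.LinGood (K.erase v) c) : D.LinGood K c := by
  rw [LinGood, linForm_eq hv, hc, C_0, zero_mul, zero_add]
  exact D.graphPoly_mul_notMem hv hd (pderiv_linForm (Finset.notMem_erase v K) c) h

/-- The coefficients of the linear form after removing a vertex `v` with two neighbours. -/
def shift (G : SimpleGraph V) [DecidableRel G.Adj] (c : V → ZMod 3) (v u : V) : ZMod 3 :=
  if G.Adj v u then c u - c v else c u

/-- Extracting the square of `X v` replaces the form by its remainder minus `c v` times the sum of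
the two neighbouring variables, which is the form with coefficients `shift G c v`. -/
lemma linGood_of_erase_shift (hv : v ∈ K) (hd : (G.neighborsIn K v).card = 2)
    (h : D.LinGood (K.erase v) (shift G c v)) : D.LinGood K c := by
  rw [LinGood, D.mul_graphPoly_mem_iff hv, linForm_eq hv, mul_assoc]
  have hq := D.pderiv_graphPoly (Finset.notMem_erase v K)
  have hm := pderiv_linForm (Finset.notMem_erase v K) c
  obtain ⟨a, b, hab, hN⟩ := Finset.card_eq_two.1 hd
  have ha : a ∈ G.neighborsIn K v := by simp [hN]
  have hb : b ∈ G.neighborsIn K v := by simp [hN]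
  rw [hN, Finset.prod_pair hab]
  refine cubeIdeal.mul_sub_mul_sub_mul_linear_notMem hq
    (pderiv_X_of_ne (mem_neighborsIn.1 ha).2.ne') (pderiv_X_of_ne (mem_neighborsIn.1 hb).2.ne')
    hm ?_
  convert h using 3
  have h1 : ∀ u ∈ K.erase v, C (shift G c v u) * X u =
      C (c u) * X u - if u ∈ G.neighborsIn K v then C (c v) * (X u : MvPolynomial V (ZMod 3))
        else 0 := by
    intro u hu
    have : u ∈ G.neighborsIn K v ↔ G.Adj v u := by
      rw [mem_neighborsIn, and_iff_right (Finset.mem_of_mem_erase hu)]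
    simp only [shift, this]
    split_ifs
    · rw [C_sub]; ring
    · ring
  rw [linForm, linForm, Finset.sum_congr rfl h1, Finset.sum_sub_distrib, Finset.sum_ite_mem,
    show K.erase v ∩ G.neighborsIn K v = {a, b} from ?_, Finset.sum_pair hab, mul_add]
  rw [← hN, Finset.inter_eq_right]
  intro u hu
  rw [mem_neighborsIn] at hu
  exact Finset.mem_erase.2 ⟨hu.2.ne', hu.1⟩

/-- Removing `v` and then its neighbour `u`, when both have degree two and different values. -/
lemma linGood_of_adj_ne (hsum : ∀ K : Finset V, K.Nonempty → G.degSum K ≤ 2 * K.card + 2)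
    {u : V} (hv : v ∈ K) (hu : u ∈ K) (h : G.Adj v u) (hdv : (G.neighborsIn K v).card = 2)
    (hdu : (G.neighborsIn K u).card ≤ 2) (hc : c u ≠ c v) : D.LinGood K c := by
  refine D.linGood_of_erase_shift hv hdv (D.linGood_of_card_le_one hsum (v := u)
    (Finset.mem_erase.2 ⟨h.ne', hu⟩) ?_ ?_)
  · have := card_neighborsIn_erase hv h.symm
    lia
  · rw [shift, if_pos h]
    exact sub_ne_zero.2 hc

/-- If `c` changes along an edge, removing one end leaves the other with degree 1 and a nonzero
coefficient. If `c` is constant along edges, take a path `v`, `a`, `x`: removing `v` makes the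
coefficient at `a` zero, so `a` can be removed too. Without triangles `x` is not adjacent to `v`, so
it keeps the coefficient `c v` while its degree drops to 1. -/
lemma linGood_of_two_regular (hsum : ∀ K : Finset V, K.Nonempty → G.degSum K ≤ 2 * K.card + 2)
    (htri : ∀ u v w, G.Adj u v → G.Adj v w → ¬ G.Adj u w)
    (hd : ∀ v ∈ K, (G.neighborsIn K v).card = 2) (hv : v ∈ K) (hc : c v ≠ 0) :
    D.LinGood K c := by
  by_cases hne : ∃ x ∈ K, ∃ y ∈ K, G.Adj x y ∧ c y ≠ c x
  · obtain ⟨x, hx, y, hy, hxy, hxy'⟩ := hne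
    exact D.linGood_of_adj_ne hsum hx hy hxy (hd x hx) (hd y hy).le hxy'
  push Not at hne
  obtain ⟨a, ha⟩ : (G.neighborsIn K v).Nonempty := by
    rw [← Finset.card_pos, hd v hv]; norm_num
  rw [mem_neighborsIn] at ha
  obtain ⟨x, hx⟩ : ((G.neighborsIn K a).erase v).Nonempty := by
    rw [← Finset.card_pos, Finset.card_erase_of_mem (mem_neighborsIn.2 ⟨hv, ha.2.symm⟩),
      hd a ha.1]
    norm_num
  rw [Finset.mem_erase, mem_neighborsIn] at hx
  obtain ⟨hxv, hxK, hax⟩ := hx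
  have hvx : ¬ G.Adj v x := htri v a x ha.2 hax
  have haK : a ∈ K.erase v := Finset.mem_erase.2 ⟨ha.2.ne', ha.1⟩
  refine D.linGood_of_erase_shift hv (hd v hv) (D.linGood_of_erase_zero (v := a) haK ?_ ?_
    (D.linGood_of_card_le_one hsum (v := x) ?_ ?_ ?_))
  · have := card_neighborsIn_erase hv ha.2.symm
    have := hd a ha.1
    lia
  · rw [shift, if_pos ha.2, hne v hv a ha.1 ha.2, sub_self]
  · exact Finset.mem_erase.2 ⟨hax.ne', Finset.mem_erase.2 ⟨hxv, hxK⟩⟩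
  · have h1 := card_neighborsIn_erase haK hax.symm
    rw [neighborsIn_erase_of_not_adj K fun h => hvx h.symm, hd x hxK] at h1
    lia
  · rw [shift, if_neg hvx, hne a ha.1 x hxK hax, hne v hv a ha.1 ha.2]
    exact hc

/-- A linear form without zero coefficients, on at most as many edges as vertices. -/
lemma linGood_of_degSum_le (hsum : ∀ K : Finset V, K.Nonempty → G.degSum K ≤ 2 * K.card + 2)
    (htri : ∀ u v w, G.Adj u v → G.Adj v w → ¬ G.Adj u w)
    (hK : K.Nonempty) (hs : G.degSum K ≤ 2 * K.card) (hc : ∀ v ∈ K, c v ≠ 0) : D.LinGood K c := by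
  by_cases h : ∃ v ∈ K, (G.neighborsIn K v).card ≤ 1
  · obtain ⟨v, hv, hd⟩ := h
    exact D.linGood_of_card_le_one hsum hv hd (hc v hv)
  · push Not at h
    obtain ⟨v, hv⟩ := hK
    exact D.linGood_of_two_regular hsum htri (card_neighborsIn_eq_two hs h) hv (hc v hv)

/-- Signs that alternate along edges, except for a zero at `w`, with all degrees at least two. -/
lemma linGood_of_two_le (hsum : ∀ K : Finset V, K.Nonempty → G.degSum K ≤ 2 * K.card + 2)
    (htri : ∀ u v w, G.Adj u v → G.Adj v w → ¬ G.Adj u w) (w : V)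
    {s : V → ZMod 3} (hs0 : ∀ v, s v ≠ 0) (hs : ∀ u ∈ K, ∀ v ∈ K, G.Adj u v → s u + s v = 0)
    (hK : K.Nonempty) (hd : ∀ v ∈ K, 2 ≤ (G.neighborsIn K v).card)
    (hcw : c w = 0 ∨ c w = s w) (hc : ∀ v ∈ K, v ≠ w → c v = s v) : D.LinGood K c := by
  have hsK := hsum K hK
  -- If all vertices but `w` had degree at least 3, the bound on the degree sum would leave at most
  -- three vertices, and a simple graph that small has too few edges.
  obtain ⟨v, hv, hvw, hdv⟩ : ∃ v ∈ K, v ≠ w ∧ (G.neighborsIn K v).card = 2 := by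
    by_contra! h
    have h1 : (K.erase w).card * 3 ≤ ∑ v ∈ K.erase w, (G.neighborsIn K v).card := by
      rw [← smul_eq_mul]
      refine Finset.card_nsmul_le_sum _ _ _ fun v hv => ?_
      rw [Finset.mem_erase] at hv
      have := hd v hv.2
      have := h v hv.2 hv.1
      lia
    have h3 := degSum_le_sq (G := G) K
    have h6 : 2 * K.card ≤ G.degSum K := by
      rw [degSum, mul_comm, ← smul_eq_mul]
      exact Finset.card_nsmul_le_sum _ _ _ hd
    have h4 := hK.card_pos
    have h5 : K.card ≤ 3 := by
      by_cases hw : w ∈ K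
      · have h2 := Finset.add_sum_erase K (fun v => (G.neighborsIn K v).card) hw
        have := hd w hw
        rw [Finset.card_erase_of_mem hw] at h1
        rw [degSum] at hsK
        lia
      · rw [Finset.erase_eq_of_notMem hw] at h1
        rw [degSum] at hsK
        lia
    have h7 : K.card = 3 := by
      interval_cases hc : K.card <;> lia
    have h8 : 8 ≤ G.degSum K := by
      by_cases hw : w ∈ K
      · have h2 := Finset.add_sum_erase K (fun v => (G.neighborsIn K v).card) hw
        have := hd w hw
        rw [Finset.card_erase_of_mem hw] at h1
        rw [degSum]
        lia
      · rw [Finset.erase_eq_of_notMem hw] at h1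
        rw [degSum]
        lia
    rw [h7] at h3
    lia
  refine D.linGood_of_erase_shift hv hdv ?_
  have hcv : c v = s v := hc v hv hvw
  -- Opposite nonzero residues have a nonzero difference mod 3. So removing `v` leaves nonzero
  -- coefficients at all its neighbours, even at `w`; a zero can persist only at `w`, when `w` is
  -- not adjacent to `v`.
  have h3 : ∀ x y : ZMod 3, x ≠ 0 → y ≠ 0 → x + y = 0 → y - x ≠ 0 := by decide
  have h4 : ∀ x ∈ K, (x ≠ w ∨ G.Adj v x) → shift G c v x ≠ 0 := by
    intro x hx h
    rw [shift]
    split_ifs with hvx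
    · rw [hcv]
      have h5 := hs v hv x hx hvx
      by_cases hxw : x = w
      · subst hxw
        rcases hcw with h0 | h0
        · rw [h0, zero_sub]; exact neg_ne_zero.2 (hs0 v)
        · rw [h0]; exact h3 _ _ (hs0 v) (hs0 x) h5
      · rw [hc x hx hxw]; exact h3 _ _ (hs0 v) (hs0 x) h5
    · have hxw := h.resolve_right hvx
      rw [hc x hx hxw]
      exact hs0 x
  have hsum' := degSum_erase (G := G) hv
  have hcard := Finset.card_erase_add_one hv
  -- The rest has at most as many edges as vertices: either it is 2-regular, or some vertex has
  -- degree at most 1. The latter has lost a neighbour, so it is adjacent to `v` and its coefficient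
  -- is nonzero.
  by_cases h : ∀ x ∈ K.erase v, 2 ≤ (G.neighborsIn (K.erase v) x).card
  · obtain ⟨a, ha⟩ : (G.neighborsIn K v).Nonempty := by
      rw [← Finset.card_pos, hdv]; norm_num
    rw [mem_neighborsIn] at ha
    refine D.linGood_of_two_regular hsum htri (card_neighborsIn_eq_two (by lia) h)
      (Finset.mem_erase.2 ⟨ha.2.ne', ha.1⟩) (h4 a ha.1 (Or.inr ha.2))
  · push Not at h
    obtain ⟨x, hx, hdx⟩ := h
    have hxK := Finset.mem_of_mem_erase hx
    refine D.linGood_of_card_le_one hsum hx (by lia) (h4 x hxK (Or.inr ?_))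
    by_contra hvx
    rw [neighborsIn_erase_of_not_adj K fun h => hvx h.symm] at hdx
    have := hd x hxK
    lia

/-- Alternating signs that vanish at `w`, with one more edge than vertices. -/
lemma linGood_of_zero_at (hsum : ∀ K : Finset V, K.Nonempty → G.degSum K ≤ 2 * K.card + 2)
    (htri : ∀ u v w, G.Adj u v → G.Adj v w → ¬ G.Adj u w) {w : V}
    {s : V → ZMod 3} (hs0 : ∀ v, s v ≠ 0) (hs : ∀ u ∈ K, ∀ v ∈ K, G.Adj u v → s u + s v = 0)
    (hw : w ∈ K) (hK : (K.erase w).Nonempty)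
    (hcw : c w = 0) (hc : ∀ v ∈ K, v ≠ w → c v = s v) : D.LinGood K c := by
  by_cases hd : ∀ v ∈ K, 2 ≤ (G.neighborsIn K v).card
  · exact D.linGood_of_two_le hsum htri w hs0 hs ⟨w, hw⟩ hd (Or.inl hcw) hc
  push Not at hd
  obtain ⟨v, hv, hdv⟩ := hd
  by_cases hvw : v = w
  · subst hvw
    -- Removing `w` itself leaves alternating signs without a zero, so any remaining vertex may play
    -- the exceptional role in `linGood_of_two_le`.
    refine D.linGood_of_erase_zero hv (by lia) hcw ?_
    by_cases hd' : ∀ x ∈ K.erase v, 2 ≤ (G.neighborsIn (K.erase v) x).card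
    · obtain ⟨x, hx⟩ := hK
      exact D.linGood_of_two_le hsum htri x hs0
        (fun a ha b hb => hs a (Finset.mem_of_mem_erase ha) b (Finset.mem_of_mem_erase hb))
        ⟨x, hx⟩ hd' (Or.inr (hc x (Finset.mem_of_mem_erase hx) (Finset.ne_of_mem_erase hx)))
        fun y hy _ => hc y (Finset.mem_of_mem_erase hy) (Finset.ne_of_mem_erase hy)
    · push Not at hd'
      obtain ⟨x, hx, hdx⟩ := hd'
      refine D.linGood_of_card_le_one hsum hx (by lia) ?_
      rw [hc x (Finset.mem_of_mem_erase hx) (Finset.ne_of_mem_erase hx)]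
      exact hs0 x
  · refine D.linGood_of_card_le_one hsum hv (by lia) ?_
    rw [hc v hv hvw]
    exact hs0 v

end EdgeOrientation

end SimpleGraph

/-! ### Alternating signs: elimination of a root -/

namespace SimpleGraph

lemma four_le_card_of_degSum {V : Type*} [Fintype V] {G : SimpleGraph V} [DecidableRel G.Adj]
    (huniv : G.degSum Finset.univ = 2 * Fintype.card V + 2) : 4 ≤ Fintype.card V := by
  classical
  have h := degSum_le_sq (G := G) Finset.univ
  rw [huniv, Finset.card_univ] at h
  by_contra! h'
  interval_cases Fintype.card V <;> lia

namespace EdgeOrientation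

/-- Alternating signs exclude odd cycles, in particular triangles. -/
lemma not_adj_of_adj_of_adj {V : Type*} {G : SimpleGraph V} {s : V → ZMod 3}
    (hs0 : ∀ v, s v ≠ 0) (hs : ∀ u v, G.Adj u v → s u + s v = 0) 
    (u v w : V) (huv : G.Adj u v) (hvw : G.Adj v w) : ¬ G.Adj u w := by
  intro huw
  have key : ∀ x y z : ZMod 3, x ≠ 0 → x + y = 0 → y + z = 0 → x + z ≠ 0 := by decide
  exact key _ _ _ (hs0 u) (hs _ _ huv) (hs _ _ hvw) (hs _ _ huw)

lemma neg_mul_eq_one {V : Type*} {G : SimpleGraph V} {s : V → ZMod 3}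
    (hs0 : ∀ v, s v ≠ 0) (hs : ∀ u v, G.Adj u v → s u + s v = 0) 
    {r a : V} (h : G.Adj r a) : -s r * s a = 1 := by
  have key : ∀ x y : ZMod 3, x ≠ 0 → x + y = 0 → -x * y = 1 := by decide
  exact key _ _ (hs0 r) (hs _ _ h)

variable {V : Type*} [Fintype V] [DecidableEq V] {G : SimpleGraph V} [DecidableRel G.Adj]
  (D : G.EdgeOrientation)

/-- The variables, with the one at `r` eliminated by the relation `∑ v, s v * X v = 0`. -/
noncomputable def rootForm (s : V → ZMod 3) (r v : V) : MvPolynomial V (ZMod 3) :=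
  if v = r then linForm (Finset.univ.erase r) (fun u => -s r * s u) else X v

lemma edgeProd_rootForm_mem_iff (s : V → ZMod 3) (r : V) :
    D.edgeProd (rootForm s r) Finset.univ ∈ cubeIdeal V ↔
      D.graphPoly (Finset.univ.erase r) * ∏ a ∈ G.neighborsIn Finset.univ r,
        (linForm (Finset.univ.erase r) (fun u => -s r * s u) - X a) ∈ cubeIdeal V := by
  obtain ⟨c, hc, h⟩ := D.edgeProd_erase (rootForm s r) (Finset.mem_univ r)
  rw [h, cubeIdeal.C_mul_mem_iff hc, D.edgeProd_congr (Z := X) fun v hv => ?_,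
    Finset.prod_congr rfl fun a ha => ?_]
  · rw [rootForm, if_pos rfl, rootForm, if_neg (mem_neighborsIn.1 ha).2.ne']
  · rw [rootForm, if_neg (Finset.ne_of_mem_erase hv)]

variable {s : V → ZMod 3} (hs0 : ∀ v, s v ≠ 0) (hs : ∀ u v, G.Adj u v → s u + s v = 0)
  (hsum : ∀ K : Finset V, K.Nonempty → G.degSum K ≤ 2 * K.card + 2)
  (huniv : G.degSum Finset.univ = 2 * Fintype.card V + 2)

include hs0 hs hsum huniv

/-- The only factor from the root is its form minus `X w`, with `w` the neighbour of `r`. The form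
has coefficient 1 at `w`, so the difference has alternating coefficients with a zero exactly at `w`.
-/
lemma edgeProd_rootForm_notMem_of_leaf {r : V} (hr : (G.neighborsIn Finset.univ r).card ≤ 1) :
    D.edgeProd (rootForm s r) Finset.univ ∉ cubeIdeal V := by
  have h4 := four_le_card_of_degSum huniv
  have hcard : (Finset.univ.erase r).card = Fintype.card V - 1 := by
    rw [Finset.card_erase_of_mem (Finset.mem_univ r), Finset.card_univ]
  have hne : (Finset.univ.erase r).Nonempty := by
    rw [← Finset.card_pos]
    lia
  have h1 := degSum_erase (G := G) (Finset.mem_univ r)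
  have h2 := hsum _ hne
  obtain ⟨w, hw⟩ : ∃ w, G.neighborsIn Finset.univ r = {w} := by
    rw [← Finset.card_eq_one]
    lia
  have hrw : G.Adj r w := (mem_neighborsIn.1 (hw ▸ Finset.mem_singleton_self w)).2
  have hwK : w ∈ Finset.univ.erase r := Finset.mem_erase.2 ⟨hrw.ne', Finset.mem_univ w⟩
  rw [edgeProd_rootForm_mem_iff, hw, Finset.prod_singleton]
  have key : linForm (Finset.univ.erase r) (fun u => -s r * s u) - X w =
      linForm (Finset.univ.erase r) (Function.update (fun u => -s r * s u) w 0) := by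
    rw [linForm_eq hwK, linForm_eq hwK, neg_mul_eq_one hs0 hs hrw, Function.update_self, C_0, C_1,
      linForm_congr (K := (Finset.univ.erase r).erase w) fun v hv => ?_]
    · ring
    · rw [Function.update_of_ne (Finset.ne_of_mem_erase hv)]
  rw [key]
  refine D.linGood_of_zero_at (w := w) (s := fun u => -s r * s u) hsum
    (not_adj_of_adj_of_adj hs0 hs) (fun v => mul_ne_zero (neg_ne_zero.2 (hs0 r)) (hs0 v))
    (fun u _ v _ h => ?_) hwK ?_ (Function.update_self ..) fun v _ hv => Function.update_of_ne hv ..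
  · rw [← mul_add, hs _ _ h, mul_zero]
  · rw [← Finset.card_pos, Finset.card_erase_of_mem hwK]
    lia

/-- Let `b` and `x` be the other neighbours of `r` and `a`. The root form is `X a + L'` with `L'`
free of `X a`, so its two factors are `L'` and `X a + L' - X b`. Together with `X a - X x` this is
quadratic in `X a`, and eliminating `a` leaves `L'` times the graph polynomial of the rest. Three
edges and two vertices are gone, so edges no longer outnumber vertices. -/
lemma edgeProd_rootForm_notMem_of_adj {r a : V} (hra : G.Adj r a)
    (hr : (G.neighborsIn Finset.univ r).card = 2) (ha : (G.neighborsIn Finset.univ a).card = 2) :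
    D.edgeProd (rootForm s r) Finset.univ ∉ cubeIdeal V := by
  have h4 := four_le_card_of_degSum huniv
  have haK : a ∈ Finset.univ.erase r := Finset.mem_erase.2 ⟨hra.ne', Finset.mem_univ a⟩
  have hcard : ((Finset.univ.erase r).erase a).card = Fintype.card V - 2 := by
    rw [Finset.card_erase_of_mem haK, Finset.card_erase_of_mem (Finset.mem_univ r),
      Finset.card_univ]
    rfl
  have h1 := degSum_erase (G := G) (Finset.mem_univ r)
  have h2 := degSum_erase (G := G) haK
  have h3 := card_neighborsIn_erase (Finset.mem_univ r) hra.symm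
  obtain ⟨b, hb⟩ : ∃ b, (G.neighborsIn Finset.univ r).erase a = {b} := by
    rw [← Finset.card_eq_one, Finset.card_erase_of_mem (mem_neighborsIn.2 ⟨Finset.mem_univ a, hra⟩),
      hr]
  obtain ⟨x, hx⟩ : ∃ x, G.neighborsIn (Finset.univ.erase r) a = {x} := by
    rw [← Finset.card_eq_one]
    lia
  have hxm : x ∈ G.neighborsIn (Finset.univ.erase r) a := by simp [hx]
  have hbm : b ∈ (G.neighborsIn Finset.univ r).erase a := by simp [hb]
  rw [edgeProd_rootForm_mem_iff, D.mul_graphPoly_mem_iff haK, hx, Finset.prod_singleton,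
    ← Finset.mul_prod_erase _ _ (mem_neighborsIn.2 ⟨Finset.mem_univ a, hra⟩), hb,
    Finset.prod_singleton, linForm_eq haK, neg_mul_eq_one hs0 hs hra]
  have hgood : D.LinGood ((Finset.univ.erase r).erase a) (fun u => -s r * s u) := by
    refine D.linGood_of_degSum_le hsum (not_adj_of_adj_of_adj hs0 hs) ?_ (by lia)
      fun v _ => mul_ne_zero (neg_ne_zero.2 (hs0 r)) (hs0 v)
    rw [← Finset.card_pos]
    lia
  have hm := pderiv_linForm (Finset.notMem_erase a (Finset.univ.erase r)) (fun u => -s r * s u)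
  have hbX : pderiv a (X b : MvPolynomial V (ZMod 3)) = 0 :=
    pderiv_X_of_ne (Finset.ne_of_mem_erase hbm)
  have := cubeIdeal.mul_sub_mul_linear_notMem (v := a) (α := X x) (c := 1)
    (m := linForm ((Finset.univ.erase r).erase a) (fun u => -s r * s u) - X b)
    (q := D.graphPoly ((Finset.univ.erase r).erase a) *
      linForm ((Finset.univ.erase r).erase a) (fun u => -s r * s u))
    (by rw [Derivation.leibniz, hm, D.pderiv_graphPoly (Finset.notMem_erase a _), smul_zero,
      smul_zero, add_zero])
    (pderiv_X_of_ne (mem_neighborsIn.1 hxm).2.ne') (by rw [map_sub, hm, hbX, sub_zero])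
    one_ne_zero hgood
  convert this using 2
  rw [C_1]
  ring

lemma exists_edgeProd_rootForm_notMem :
    ∃ r, D.edgeProd (rootForm s r) Finset.univ ∉ cubeIdeal V := by
  by_cases hleaf : ∃ r, (G.neighborsIn Finset.univ r).card ≤ 1
  · obtain ⟨r, hr⟩ := hleaf
    exact ⟨r, D.edgeProd_rootForm_notMem_of_leaf hs0 hs hsum huniv hr⟩
  by_cases hadj : ∃ r a, G.Adj r a ∧ (G.neighborsIn Finset.univ r).card = 2 ∧
      (G.neighborsIn Finset.univ a).card = 2
  · obtain ⟨r, a, hra, hr, ha⟩ := hadj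
    exact ⟨r, D.edgeProd_rootForm_notMem_of_adj hs0 hs hsum huniv hra hr ha⟩
  -- what remains is the complete bipartite graph with parts of sizes two and three
  push Not at hleaf hadj
  replace hleaf : ∀ v, 2 ≤ (G.neighborsIn Finset.univ v).card := hleaf
  have htri := not_adj_of_adj_of_adj hs0 hs
  have h4 := four_le_card_of_degSum huniv
  have : Nonempty V := Fintype.card_pos_iff.1 (by lia)
  obtain ⟨r, -, hr⟩ := exists_card_neighborsIn_le_two hsum Finset.univ Finset.univ_nonempty
  replace hr : (G.neighborsIn Finset.univ r).card = 2 := le_antisymm hr (hleaf r)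
  obtain ⟨a, b, hab, hN⟩ := Finset.card_eq_two.1 hr
  have hra : G.Adj r a := (mem_neighborsIn.1 (hN ▸ (by simp) : a ∈ G.neighborsIn Finset.univ r)).2
  have hrb : G.Adj r b := (mem_neighborsIn.1 (hN ▸ (by simp) : b ∈ G.neighborsIn Finset.univ r)).2
  have hab' : ¬ G.Adj a b := htri a r b hra.symm hrb
  have hda := hadj r a hra hr
  have hdb := hadj r b hrb hr
  have hla := hleaf a
  have hlb := hleaf b
  have hbe : b ∈ Finset.univ.erase a := Finset.mem_erase.2 ⟨hab.symm, Finset.mem_univ b⟩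
  have hcard : ((Finset.univ.erase a).erase b).card = Fintype.card V - 2 := by
    rw [Finset.card_erase_of_mem hbe, Finset.card_erase_of_mem (Finset.mem_univ a),
      Finset.card_univ]
    rfl
  have hsplit : G.degSum Finset.univ = (G.neighborsIn Finset.univ a).card +
      ((G.neighborsIn Finset.univ b).card +
        ∑ v ∈ (Finset.univ.erase a).erase b, (G.neighborsIn Finset.univ v).card) := by
    have h5 := Finset.add_sum_erase _ (fun v => (G.neighborsIn Finset.univ v).card) hbe
    have h6 := Finset.add_sum_erase _ (fun v => (G.neighborsIn Finset.univ v).card)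
      (Finset.mem_univ a)
    rw [degSum]
    lia
  have hge : ∑ v ∈ (Finset.univ.erase a).erase b, 2 ≤
      ∑ v ∈ (Finset.univ.erase a).erase b, (G.neighborsIn Finset.univ v).card :=
    Finset.sum_le_sum fun v _ => hleaf v
  have heq := Finset.sum_eq_sum_iff_of_le
    (fun (v : V) (_ : v ∈ (Finset.univ.erase a).erase b) => hleaf v)
  rw [Finset.sum_const, smul_eq_mul, hcard] at hge heq
  -- The degrees exceed 2 by a total of exactly 2, and `a` and `b` each take at least 1: both have
  -- degree 3 and every other vertex has degree 2.
  have hd2 := heq.1 (by lia)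
  have hda3 : (G.neighborsIn Finset.univ a).card = 3 := by lia
  have hmem : ∀ v, v ≠ a → v ≠ b → G.neighborsIn Finset.univ v = {a, b} := by
    intro v hva hvb
    have hv2 := hd2 v (Finset.mem_erase.2 ⟨hvb, Finset.mem_erase.2 ⟨hva, Finset.mem_univ v⟩⟩)
    refine Finset.eq_of_subset_of_card_le (fun u hu => ?_) (by rw [Finset.card_pair hab, ← hv2])
    by_contra hu'
    simp only [Finset.mem_insert, Finset.mem_singleton, not_or] at hu'
    exact hadj v u (mem_neighborsIn.1 hu).2 hv2.symm
      (hd2 u (Finset.mem_erase.2 ⟨hu'.2, Finset.mem_erase.2 ⟨hu'.1, Finset.mem_univ u⟩⟩)).symm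
  have hadja : ∀ v, v ≠ a → v ≠ b → G.Adj v a := fun v h h' =>
    (mem_neighborsIn.1 ((hmem v h h').symm ▸ (by simp) : a ∈ G.neighborsIn Finset.univ v)).2
  have hadjb : ∀ v, v ≠ a → v ≠ b → G.Adj v b := fun v h h' =>
    (mem_neighborsIn.1 ((hmem v h h').symm ▸ (by simp) : b ∈ G.neighborsIn Finset.univ v)).2
  have hiff : ∀ v, G.Adj a v ↔ v ≠ a ∧ v ≠ b := fun v =>
    ⟨fun h => ⟨h.ne', fun h' => hab' (h' ▸ h)⟩, fun h => (hadja v h.1 h.2).symm⟩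
  have hiffb : ∀ v, G.Adj b v ↔ v ≠ a ∧ v ≠ b := fun v =>
    ⟨fun h => ⟨fun h' => hab' (h' ▸ h.symm), h.ne'⟩, fun h => (hadjb v h.1 h.2).symm⟩
  have hra_mem : r ∈ G.neighborsIn Finset.univ a := mem_neighborsIn.2 ⟨Finset.mem_univ r, hra.symm⟩
  obtain ⟨x, y, hxy, hxy'⟩ : ∃ x y, x ≠ y ∧ (G.neighborsIn Finset.univ a).erase r = {x, y} := by
    rw [← Finset.card_eq_two, Finset.card_erase_of_mem hra_mem, hda3]
  have hall : ∀ v, (v ≠ r ∧ v ≠ a ∧ v ≠ b) ↔ v = x ∨ v = y := by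
    intro v
    have : v ∈ (G.neighborsIn Finset.univ a).erase r ↔ v ∈ ({x, y} : Finset V) := by rw [hxy']
    simpa [mem_neighborsIn, hiff] using this
  obtain ⟨hxr, hxa, hxb⟩ := (hall x).2 (Or.inl rfl)
  obtain ⟨hyr, hya, hyb⟩ := (hall y).2 (Or.inr rfl)
  have hK : Finset.univ.erase r = {a, b, x, y} := by
    ext v
    have := hall v
    have := hra.ne'
    have := hrb.ne'
    simp only [Finset.mem_erase, Finset.mem_univ, Finset.mem_insert, Finset.mem_singleton]
    grind
  have hKa : ({a, b, x, y} : Finset V).erase a = {b, x, y} := by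
    rw [Finset.erase_insert]; simp [hab, hxa.symm, hya.symm]
  have hKb : ({b, x, y} : Finset V).erase b = {x, y} := by
    rw [Finset.erase_insert]; simp [hxb.symm, hyb.symm]
  have hNa : G.neighborsIn {a, b, x, y} a = {x, y} := by
    ext v
    simp only [mem_neighborsIn, hiff, Finset.mem_insert, Finset.mem_singleton]
    grind
  have hNb : G.neighborsIn {b, x, y} b = {x, y} := by
    ext v
    simp only [mem_neighborsIn, hiffb, Finset.mem_insert, Finset.mem_singleton]
    grind
  have hnxy : ¬ G.Adj x y := htri x a y (hadja x hxa hxb) (hadja y hya hyb).symm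
  have hone : D.graphPoly {x, y} = 1 := by
    rw [graphPoly, edgeProd, Finset.filter_eq_empty_iff.2, Finset.prod_empty]
    intro e _ he
    have h5 := D.adj e
    simp only [Finset.mem_insert, Finset.mem_singleton] at he
    rcases he with ⟨h | h, h' | h'⟩ <;> rw [h, h'] at h5
    exacts [h5.ne rfl, hnxy h5, hnxy h5.symm, h5.ne rfl]
  have hsx : ∀ v, G.Adj a v → -s r * s v = -1 := by
    intro v hv
    have h5 := neg_mul_eq_one hs0 hs hra
    have h6 := hs a v hv
    linear_combination -s r * h6 - h5
  have hL : linForm {a, b, x, y} (fun u => -s r * s u) = X a + X b - X x - X y := by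
    rw [linForm, Finset.sum_insert (by simp [hab, hxa.symm, hya.symm]),
      Finset.sum_insert (by simp [hxb.symm, hyb.symm]), Finset.sum_pair hxy,
      neg_mul_eq_one hs0 hs hra, neg_mul_eq_one hs0 hs hrb, hsx x (hadja x hxa hxb).symm,
      hsx y (hadja y hya hyb).symm]
    simp only [C_1, C_neg]
    ring
  refine ⟨r, ?_⟩
  rw [edgeProd_rootForm_mem_iff, hN, Finset.prod_pair hab, hK, hL,
    D.mul_graphPoly_mem_iff (v := a) (by simp), hNa, hKa, Finset.prod_pair hxy, mul_assoc,
    D.mul_graphPoly_mem_iff (v := b) (by simp), hNb, hKb, Finset.prod_pair hxy, hone, one_mul]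
  have e1 : pderiv a (X b : MvPolynomial V (ZMod 3)) = 0 := pderiv_X_of_ne hab.symm
  have e2 : pderiv a (X x : MvPolynomial V (ZMod 3)) = 0 := pderiv_X_of_ne hxa
  have e3 : pderiv a (X y : MvPolynomial V (ZMod 3)) = 0 := pderiv_X_of_ne hya
  have e4 : pderiv b (X x : MvPolynomial V (ZMod 3)) = 0 := pderiv_X_of_ne hxb
  have e5 : pderiv b (X y : MvPolynomial V (ZMod 3)) = 0 := pderiv_X_of_ne hyb
  have e6 : pderiv x (X y : MvPolynomial V (ZMod 3)) = 0 := pderiv_X_of_ne hxy.symm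
  -- The root factors are `X b - X x - X y` and `X a - X x - X y`. Eliminating `a` and then `b`
  -- contributes each time `-2 * (X x + X y) = X x + X y`, so the square of this sum remains.
  have f1 : (X x + X y) * (X x + X y) ∉ cubeIdeal V := by
    have := cubeIdeal.mul_sub_mul_sub_notMem (v := x) (q := 1) (α := -X y) (β := -X y)
      pderiv_one (by simp [e6]) (by simp [e6]) cubeIdeal.one_notMem
    simpa only [one_mul, sub_neg_eq_add] using this
  have f2 : (X x + X y) * ((X b - X x) * (X b - X y) * (C 1 * X b + (-X x - X y))) ∉
      cubeIdeal V := by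
    refine cubeIdeal.mul_sub_mul_sub_mul_linear_notMem (by simp [e4, e5]) e4 e5
      (by simp [e4, e5]) ?_
    convert f1 using 2
    rw [C_1]
    linear_combination (-(X x + X y) * (X x + X y)) * cubeIdeal.three_eq_zero (σ := V)
  have f3 := cubeIdeal.mul_sub_mul_sub_mul_linear_notMem (v := a) (c := 1) (α := X x) (β := X y)
    (m := -X x - X y) (q := (X b - X x) * (X b - X y) * (C 1 * X b + (-X x - X y)))
    (by simp [Derivation.leibniz, e1, e2, e3]) e2 e3 (by simp [e2, e3]) ?_
  · convert f3 using 2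
    rw [C_1]
    ring
  · convert f2 using 2
    rw [C_1]
    linear_combination (-(X x + X y) * ((X b - X x) * (X b - X y) * (1 * X b + (-X x - X y)))) *
      cubeIdeal.three_eq_zero (σ := V)

end EdgeOrientation

end SimpleGraph

/-! ### Permanents as coefficients of the product of the rows -/

section Permanent

variable {n : Type*} [Fintype n]

/-- The product of the row forms of a square matrix. -/
noncomputable def Matrix.rowProd {R : Type*} [CommRing R] (A : Matrix n n R) : MvPolynomial n R :=
  ∏ i, ∑ j, C (A i j) * X j

namespace Matrix

variable {R : Type*} [CommRing R]

lemma rowForm_isHomogeneous (A : Matrix n n R) (i : n) :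
    (∑ j, C (A i j) * X j : MvPolynomial n R).IsHomogeneous 1 :=
  IsHomogeneous.sum _ _ _ fun _ _ => isHomogeneous_C_mul_X _ _

lemma rowProd_isHomogeneous (A : Matrix n n R) : A.rowProd.IsHomogeneous (Fintype.card n) := by
  have := IsHomogeneous.prod Finset.univ _ (fun _ => 1) fun i _ => A.rowForm_isHomogeneous i
  simpa [rowProd] using this

variable [DecidableEq n]

/-- For each permutation in the permanent, summing over all `f` expands the same product of row
forms, merely reordered. -/
lemma sum_monomial_permanent (A : Matrix n n R) :
    ∑ f : n → n, monomial (∑ i, Finsupp.single (f i) 1) (A.submatrix id f).permanent =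
      (Fintype.card n).factorial • A.rowProd := by
  have h1 : ∀ f : n → n, monomial (∑ i, Finsupp.single (f i) 1) (A.submatrix id f).permanent =
      ∑ σ : Equiv.Perm n, ∏ i, (C (A (σ i) (f i)) * X (f i) : MvPolynomial n R) := by
    intro f
    rw [permanent, map_sum]
    refine Finset.sum_congr rfl fun σ _ => ?_
    simp only [C_mul_X_eq_monomial, submatrix_apply, id_eq]
    rw [monomial_sum_prod]
  have h2 : ∀ σ : Equiv.Perm n,
      ∑ f : n → n, ∏ i, (C (A (σ i) (f i)) * X (f i) : MvPolynomial n R) = A.rowProd := by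
    intro σ
    have := Finset.prod_univ_sum (fun _ : n => (Finset.univ : Finset n))
      (fun i j => (C (A (σ i) j) * X j : MvPolynomial n R))
    rw [Fintype.piFinset_univ] at this
    rw [← this]
    exact Equiv.prod_comp σ fun i => ∑ j, (C (A i j) * X j : MvPolynomial n R)
  rw [Finset.sum_congr rfl fun f _ => h1 f, Finset.sum_comm, Finset.sum_congr rfl fun σ _ => h2 σ,
    Finset.sum_const, Finset.card_univ, Fintype.card_perm]

lemma exists_permanent_ne_zero {A : Matrix n n ℝ} {k : n →₀ ℕ} (h : coeff k A.rowProd ≠ 0) :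
    ∃ f : n → n, (∀ j, (Finset.univ.filter fun i => f i = j).card = k j) ∧
      (A.submatrix id f).permanent ≠ 0 := by
  have h1 := congrArg (coeff k) A.sum_monomial_permanent
  rw [coeff_sum, coeff_smul] at h1
  have h2 : (Fintype.card n).factorial • coeff k A.rowProd ≠ 0 :=
    smul_ne_zero (Nat.factorial_ne_zero _) h
  rw [← h1] at h2
  obtain ⟨f, -, hf⟩ := Finset.exists_ne_zero_of_sum_ne_zero h2
  rw [coeff_monomial] at hf
  obtain ⟨hk, hp⟩ := ite_ne_right_iff.1 hf
  refine ⟨f, fun j => ?_, hp⟩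
  rw [← hk, Finsupp.finsetSum_apply, Finset.card_filter]
  exact Finset.sum_congr rfl fun i _ => (Finsupp.single_apply ..).symm

/-- Constants affect only the terms below the top degree. -/
lemma coeff_prod_add_C (A : Matrix n n R) (b : n → R) {k : n →₀ ℕ}
    (hk : k.degree = Fintype.card n) :
    coeff k (∏ i, (∑ j, C (A i j) * X j + C (b i))) = coeff k A.rowProd := by
  rw [Finset.prod_add, coeff_sum, Finset.sum_eq_single Finset.univ]
  · simp [rowProd]
  · intro t _ ht
    have h1 : (∏ i ∈ t, ∑ j, C (A i j) * X j : MvPolynomial n R).IsHomogeneous t.card := by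
      simpa using IsHomogeneous.prod t _ (fun _ => 1) fun i _ => A.rowForm_isHomogeneous i
    have h2 := h1.mul (isHomogeneous_C n (∏ i ∈ Finset.univ \ t, b i))
    rw [map_prod, add_zero] at h2
    refine h2.coeff_eq_zero ?_
    rw [hk]
    exact ((Finset.card_lt_iff_ne_univ t).2 ht).ne'
  · simp

/-- The combinatorial Nullstellensatz for products of affine forms. -/
lemma exists_forall_affine_ne_zero {A : Matrix n n ℝ} {k : n →₀ ℕ} (h : coeff k A.rowProd ≠ 0)
    (b : n → ℝ) (L : n → Finset ℝ) (hL : ∀ i, k i < (L i).card) :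
    ∃ x : n → ℝ, (∀ i, x i ∈ L i) ∧ ∀ i, ∑ j, A i j * x j + b i ≠ 0 := by
  have hk : k.degree = Fintype.card n := by
    by_contra hne
    exact h (A.rowProd_isHomogeneous.coeff_eq_zero hne)
  have h1 := A.coeff_prod_add_C b hk
  rw [← h1] at h
  have hdeg : (∏ i, (∑ j, C (A i j) * X j + C (b i)) : MvPolynomial n ℝ).totalDegree =
      k.degree := by
    refine le_antisymm ?_ (le_totalDegree (mem_support_iff.2 h))
    rw [hk]
    refine (totalDegree_finsetProd _ _).trans ?_
    rw [← Finset.card_univ, Finset.card_eq_sum_ones]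
    refine Finset.sum_le_sum fun i _ => (totalDegree_add _ _).trans ?_
    rw [totalDegree_C]
    exact max_le (A.rowForm_isHomogeneous i).totalDegree_le zero_le_one
  obtain ⟨x, hx, hne⟩ := combinatorial_nullstellensatz_exists_eval_nonzero _ k h hdeg L hL
  refine ⟨x, hx, fun i => ?_⟩
  rw [map_prod, Finset.prod_ne_zero_iff] at hne
  simpa using hne i (Finset.mem_univ i)

end Matrix

end Permanent

/-! ### The incidence map mod 3 and the substitution -/

namespace SimpleGraph

variable {V : Type*} [Fintype V] [DecidableEq V] {G : SimpleGraph V} [DecidableRel G.Adj]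

/-- The sum of the weights of the edges incident to a vertex, as a linear map. -/
def incidenceSum (G : SimpleGraph V) [DecidableRel G.Adj] :
    (G.edgeSet → ZMod 3) →ₗ[ZMod 3] (V → ZMod 3) where
  toFun w v := ∑ e ∈ Finset.univ.filter (fun e : G.edgeSet => v ∈ (e : Sym2 V)), w e
  map_add' w w' := by ext v; simp [Finset.sum_add_distrib]
  map_smul' c w := by ext v; simp [Finset.mul_sum]

lemma single_add_single_mem {u v : V} (h : G.Adj u v) :
    Pi.single u 1 + Pi.single v 1 ∈ LinearMap.range G.incidenceSum := by
  refine ⟨Pi.single ⟨s(u, v), (mem_edgeSet G).2 h⟩ 1, ?_⟩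
  ext x
  have hne := h.ne
  simp only [incidenceSum, LinearMap.coe_mk, AddHom.coe_mk, Pi.add_apply]
  simp only [Pi.single_apply, Finset.sum_ite_eq', Finset.mem_filter, Finset.mem_univ, true_and,
    Sym2.mem_iff]
  by_cases h1 : x = u
  · subst h1; simp [hne]
  · simp [h1]

/-- Alternating sum of the edge relations along the walk; the empty walk gives `c = -1`. -/
lemma Walk.exists_single_add_smul_mem {u v : V} (p : G.Walk u v) :
    ∃ c : ZMod 3, c ≠ 0 ∧
      Pi.single u 1 + c • Pi.single v 1 ∈ LinearMap.range G.incidenceSum := by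
  induction p with
  | nil => exact ⟨-1, by decide, by simp⟩
  | cons h p ih =>
    obtain ⟨c, hc, hm⟩ := ih
    refine ⟨-c, neg_ne_zero.2 hc, ?_⟩
    convert sub_mem (single_add_single_mem h) hm using 1
    module

lemma sum_incident_eq (w : V → G.edgeSet → ZMod 3) (u : V) :
    ∑ e ∈ Finset.univ.filter (fun e : G.edgeSet => u ∈ (e : Sym2 V)),
        ∑ v, (C (w v e) * X v : MvPolynomial V (ZMod 3)) =
      ∑ v, C (G.incidenceSum (w v) u) * X v := by
  rw [Finset.sum_comm]
  refine Finset.sum_congr rfl fun v _ => ?_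
  rw [← Finset.sum_mul, ← map_sum]
  rfl

namespace EdgeOrientation

variable (D : G.EdgeOrientation)

/-- The difference of the incidence vectors of the head and the tail of an edge. -/
def incidenceDiff (R : Type*) [CommRing R] : Matrix G.edgeSet G.edgeSet R :=
  Matrix.of fun e y => (if D.head e ∈ (y : Sym2 V) then 1 else 0) -
    (if D.tail e ∈ (y : Sym2 V) then 1 else 0)

/-- On the diagonal both ends are incident and `1 - 1` gives the prescribed 0; no other edge
contains both ends of `e`. -/
lemma edgeMatrix_eq {V : Type*} [DecidableEq V] {G : SimpleGraph V} (D : G.EdgeOrientation) :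
    edgeMatrix D = D.incidenceDiff ℝ := by
  ext e y
  have hh : D.head e ∈ (e : Sym2 V) := by rw [← D.mk_tail_head]; simp
  have ht : D.tail e ∈ (e : Sym2 V) := by rw [← D.mk_tail_head]; simp
  simp only [edgeMatrix, totalMatrix, Matrix.submatrix_apply, id_eq, Matrix.of_apply, Touches,
    incidenceDiff]
  by_cases hye : y = e
  · subst hye
    simp [hh, ht]
  · have : ¬ (D.head e ∈ (y : Sym2 V) ∧ D.tail e ∈ (y : Sym2 V)) := by
      intro h
      apply hye
      apply Subtype.ext
      rw [← D.mk_tail_head e]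
      exact (Sym2.mem_and_mem_iff (D.adj e).ne).1 ⟨h.2, h.1⟩
    by_cases h1 : D.head e ∈ (y : Sym2 V) <;> by_cases h2 : D.tail e ∈ (y : Sym2 V)
    · exact absurd ⟨h1, h2⟩ this
    all_goals simp [hye, h1, h2]

lemma sum_incidenceDiff_mul {R A : Type*} [CommRing R] [CommRing A] [Algebra R A]
    (t : G.edgeSet → A) (e : G.edgeSet) :
    ∑ y, algebraMap R A (D.incidenceDiff R e y) * t y =
      ∑ y ∈ Finset.univ.filter (fun y : G.edgeSet => D.head e ∈ (y : Sym2 V)), t y -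
        ∑ y ∈ Finset.univ.filter (fun y : G.edgeSet => D.tail e ∈ (y : Sym2 V)), t y := by
  simp only [incidenceDiff, Matrix.of_apply, map_sub, sub_mul, Finset.sum_sub_distrib,
    Finset.sum_filter]
  congr 1 <;> refine Finset.sum_congr rfl fun y _ => ?_ <;> split_ifs <;> simp

lemma map_rowProd_incidenceDiff (R : Type*) [CommRing R] :
    MvPolynomial.map (Int.castRingHom R) (D.incidenceDiff ℤ).rowProd =
      (D.incidenceDiff R).rowProd := by
  simp only [Matrix.rowProd, map_prod, map_sum, map_mul, map_C, map_X]
  congr! 6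
  simp only [incidenceDiff, Matrix.of_apply, map_sub]
  split_ifs <;> simp

lemma aeval_rowProd_incidenceDiff (t : G.edgeSet → MvPolynomial V (ZMod 3)) :
    aeval t (D.incidenceDiff (ZMod 3)).rowProd =
      D.edgeProd (fun v => ∑ y ∈ Finset.univ.filter (fun y : G.edgeSet => v ∈ (y : Sym2 V)), t y)
        Finset.univ := by
  simp only [Matrix.rowProd, map_prod, map_sum, map_mul, aeval_C, aeval_X, sum_incidenceDiff_mul,
    edgeProd, Finset.mem_univ, true_and, Finset.filter_true]

/-- Substituting `∑ v, C (w v e) * X v` for the variable of `e` maps the cube ideal into the cube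
ideal and the row product to the edge product of `Y`. -/
lemma rowProd_notMem_of {Y : V → MvPolynomial V (ZMod 3)} (w : V → G.edgeSet → ZMod 3)
    (hw : ∀ u, ∑ v, C (G.incidenceSum (w v) u) * X v = Y u)
    (h : D.edgeProd Y Finset.univ ∉ cubeIdeal V) :
    (D.incidenceDiff (ZMod 3)).rowProd ∉ cubeIdeal G.edgeSet := by
  intro hmem
  have h1 := cubeIdeal.aeval_mem (t := fun e => ∑ v, C (w v e) * X v)
    (fun e => cubeIdeal.linear_pow_three_mem fun v => w v e) hmem
  rw [aeval_rowProd_incidenceDiff] at h1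
  simp only [sum_incident_eq, hw] at h1
  exact h h1

/-- By connectedness each unit vector is a multiple of the one at `q` modulo the range of the
incidence map, so the range has codimension at most 1. The cases are codimension 0 and 1. -/
lemma rowProd_notMem (hG : G.Connected) (hcard : G.edgeFinset.card = Fintype.card V + 1) :
    (D.incidenceDiff (ZMod 3)).rowProd ∉ cubeIdeal G.edgeSet := by
  have huniv : G.degSum Finset.univ = 2 * Fintype.card V + 2 := by rw [degSum_univ, hcard]; ring
  have hsum : ∀ K : Finset V, K.Nonempty → G.degSum K ≤ 2 * K.card + 2 := by
    intro K hK
    have := hG.degSum_add_le K hK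
    lia
  obtain ⟨q⟩ := hG.nonempty
  have hex : ∀ v, ∃ c : ZMod 3, c ≠ 0 ∧
      Pi.single v 1 + c • Pi.single q 1 ∈ LinearMap.range G.incidenceSum := fun v =>
    (hG.preconnected v q).some.exists_single_add_smul_mem
  choose s hs0 hsmem using hex
  by_cases hq : Pi.single q 1 ∈ LinearMap.range G.incidenceSum
  · have hall : ∀ v, ∃ w, G.incidenceSum w = Pi.single v 1 := by
      intro v
      have := sub_mem (hsmem v) (Submodule.smul_mem _ (s v) hq)
      rwa [add_sub_cancel_right] at this
    choose w hw using hall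
    refine D.rowProd_notMem_of (Y := X) w (fun u => ?_)
      (D.graphPoly_notMem (exists_card_neighborsIn_le_two hsum) Finset.univ)
    rw [Finset.sum_eq_single u]
    · simp [hw]
    · intro v _ hv
      simp [hw, hv.symm]
    · simp
  -- An edge whose signs do not cancel would put a nonzero multiple of the unit vector at `q` into
  -- the range.
  · have hs : ∀ u v, G.Adj u v → s u + s v = 0 := by
      intro u v huv
      by_contra hne
      apply hq
      have h1 := sub_mem (add_mem (hsmem u) (hsmem v)) (single_add_single_mem huv)
      have h2 := Submodule.smul_mem _ (s u + s v)⁻¹ h1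
      convert h2 using 1
      rw [show (Pi.single u 1 + s u • Pi.single q 1 + (Pi.single v 1 + s v • Pi.single q 1) -
        (Pi.single u 1 + Pi.single v 1) : V → ZMod 3) = (s u + s v) • Pi.single q 1 by module,
        smul_smul, inv_mul_cancel₀ hne, one_smul]
    obtain ⟨r, hr⟩ := D.exists_edgeProd_rootForm_notMem hs0 hs hsum huniv
    -- These vectors realise `rootForm`: the contributions at `q` cancel because `s r * s r = 1`,
    -- and the zero at `r` removes the variable `X r`.
    have hall : ∀ v, ∃ w, G.incidenceSum w =
        if v = r then 0 else Pi.single v 1 + (-s r * s v) • Pi.single r 1 := by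
      intro v
      split_ifs
      · exact ⟨0, map_zero _⟩
      · have h1 := add_mem (hsmem v) (Submodule.smul_mem _ (-s r * s v) (hsmem r))
        have h2 : s v + -s r * s v * s r = 0 := by
          have key : ∀ x y : ZMod 3, x ≠ 0 → y + -x * y * x = 0 := by decide
          exact key _ _ (hs0 r)
        have h3 : (Pi.single v 1 + s v • Pi.single q 1 +
            (-s r * s v) • (Pi.single r 1 + s r • Pi.single q 1) : V → ZMod 3) =
            Pi.single v 1 + (-s r * s v) • Pi.single r 1 +
              (s v + -s r * s v * s r) • Pi.single q 1 := by module
        rwa [h3, h2, zero_smul, add_zero] at h1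
    choose w hw using hall
    refine D.rowProd_notMem_of w (fun u => ?_) hr
    rw [rootForm]
    split_ifs with hu
    · subst hu
      rw [linForm, ← Finset.add_sum_erase _ _ (Finset.mem_univ u), hw, if_pos rfl, Pi.zero_apply,
        C_0, zero_mul, zero_add]
      refine Finset.sum_congr rfl fun v hv => ?_
      have hv' := Finset.ne_of_mem_erase hv
      simp [hw, hv', hv'.symm]
    · rw [Finset.sum_eq_single u]
      · simp [hw, hu]
      · intro v _ hv
        rw [hw]
        split_ifs
        · simp
        · simp [hv.symm, hu]
      · simp

lemma exists_coeff_rowProd_ne_zero (hG : G.Connected)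
    (hcard : G.edgeFinset.card = Fintype.card V + 1) :
    ∃ k : G.edgeSet →₀ ℕ, coeff k (edgeMatrix D).rowProd ≠ 0 ∧ ∀ e, k e ≤ 2 := by
  obtain ⟨k, hk, hk2⟩ := cubeIdeal.exists_coeff_ne_zero (D.rowProd_notMem hG hcard)
  refine ⟨k, ?_, hk2⟩
  rw [← map_rowProd_incidenceDiff, coeff_map] at hk
  -- Both coefficients come from one integer, nonzero because it is nonzero mod 3.
  rw [edgeMatrix_eq, ← map_rowProd_incidenceDiff, coeff_map, eq_intCast, Int.cast_ne_zero]
  rintro h0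
  rw [h0, map_zero] at hk
  exact hk rfl

end EdgeOrientation

/-! ### From coefficients to weightings -/

lemma nonempty_edgeOrientation {V : Type*} (G : SimpleGraph V) : Nonempty G.EdgeOrientation := by
  have h : ∀ e : G.edgeSet, ∃ a b, s(a, b) = (e : Sym2 V) := by
    rintro ⟨e, he⟩
    induction e with
    | _ a b => exact ⟨a, b, rfl⟩
  choose a b hab using h
  exact ⟨⟨a, b, hab⟩⟩

/-- With the vertex weights forced, the weight difference along each edge is an affine form in the
edge weights whose linear part is a row of the edge matrix. Exponents at most 2 are below the list
size 3. -/
lemma isChoosable_one_three_of_coeff_ne_zero (D : G.EdgeOrientation) {k : G.edgeSet →₀ ℕ}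
    (hk : coeff k (edgeMatrix D).rowProd ≠ 0) (hk2 : ∀ e, k e ≤ 2) : G.IsChoosable 1 3 := by
  intro L hL
  have hne : ∀ v : V, (L (Sum.inl v)).Nonempty := fun v => by
    rw [← Finset.card_pos, hL]; exact one_pos
  choose a ha using hne
  obtain ⟨x, hx, hx0⟩ := Matrix.exists_forall_affine_ne_zero hk
    (fun e => a (D.head e) - a (D.tail e))
    (fun e => L (Sum.inr e)) fun e => by rw [hL]; exact Nat.lt_succ_of_le (hk2 e)
  refine ⟨Sum.elim a x, ?_, ?_⟩
  · rintro (v | e)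
    exacts [ha v, hx e]
  · have key : ∀ e, G.vertexWeight (Sum.elim a x) (D.head e) ≠
        G.vertexWeight (Sum.elim a x) (D.tail e) := by
      intro e heq
      apply hx0 e
      have h1 := D.sum_incidenceDiff_mul (R := ℝ) x e
      simp only [Algebra.algebraMap_self, RingHom.id_apply] at h1
      rw [D.edgeMatrix_eq, h1]
      simp only [vertexWeight, Sum.elim_inl, Sum.elim_inr] at heq
      linarith
    intro u v huv
    have h1 : s(D.tail ⟨s(u, v), huv⟩, D.head ⟨s(u, v), huv⟩) = s(u, v) := D.mk_tail_head _
    have h2 := key ⟨s(u, v), huv⟩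
    rcases Sym2.eq_iff.1 h1 with ⟨h, h'⟩ | ⟨h, h'⟩ <;> rw [h, h'] at h2
    exacts [h2.symm, h2]

end SimpleGraph

theorem theorem3p4 {V : Type*} [Fintype V] [DecidableEq V] (B : SimpleGraph V)
    [DecidableRel B.Adj] (hB : B.IsBicyclic) :
    (∀ D : B.EdgeOrientation, (SimpleGraph.edgeMatrix D).pind ≤ 2) ∧ B.IsChoosable 1 3 := by
  refine ⟨fun D => ?_, ?_⟩
  · obtain ⟨k, hk, hk2⟩ := D.exists_coeff_rowProd_ne_zero hB.1 hB.2
    obtain ⟨f, hf, hper⟩ := Matrix.exists_permanent_ne_zero hk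
    exact iInf₂_le 2 ⟨f, fun j => (hf j).trans_le (hk2 j), hper⟩
  · obtain ⟨D⟩ := B.nonempty_edgeOrientation
    obtain ⟨k, hk, hk2⟩ := D.exists_coeff_rowProd_ne_zero hB.1 hB.2
    exact SimpleGraph.isChoosable_one_three_of_coeff_ne_zero D hk hk2
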